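/- A convex body in $\mathbb{R}^n$ is a compact convex set with non-empty interior; it is centered if its center of mass $\frac1{|K|}\int_K x\,dx$ is the origin. For a centered convex body $K\subset\mathbb{R}^n$ and $q\ge 1$, let $Z_q^+(K)$ be the convex body with support function $$h_{Z_q^+(K)}(y)=\left(\frac{2}{|K|}\int_K \langle x,y\rangle_+^q\,dx\right)^{1/q},\qquad a_+=\max\{a,0\},$$ that is, $Z_q^+(K)=\{x:\langle x,y\rangle\le h_{Z_q^+(K)}(y)\text{ for all }y\in\mathbb{R}^n\}$. **Theorem.** There exist absolute constants $c_1,c_2>0$ and, for every $\beta\in(0,1)$, a constant $\alpha=\alpha(\beta)>1$ depending only on $\beta$, with the following property. Let $n\ge 1$, let $K$ be a centered convex body in $\mathbb{R}^n$ and let $N\ge\alpha n$ be an integer. Then there exists a real number $q\ge 1$ with $q\ge c_1\beta\log(N/n)$ such that, whenever $x_1,\dots,x_N$ are independent random points uniformly distributed in $K$, $$\operatorname{conv}(\{x_1,\dots,x_N\})\supseteq c_2\,Z_q^+(K)$$ with probability greater than $1-\exp(-N^{1-\beta}n^{\beta})$. -/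

import Mathlib

open MeasureTheory ProbabilityTheory
open scoped Pointwise

/-- The center of mass `|K|⁻¹ ∫_K x dx` of a set `K` in `ℝⁿ`. -/
noncomputable def centerOfMass {n : ℕ} (K : Set (EuclideanSpace ℝ (Fin n))) :
    EuclideanSpace ℝ (Fin n) :=
  ⨍ x in K, x

/-- The function `y ↦ (2 |K|⁻¹ ∫_K ⟨x, y⟩₊^q dx)^{1/q}`, where `a₊ = max a 0`.
The integral is taken with respect to the uniform probability measure on `K`; when `K` has volume
one this is `(2 ∫_K ⟨x, y⟩₊^q dx)^{1/q}`. -/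
noncomputable def oneSidedSupportFun {n : ℕ} (K : Set (EuclideanSpace ℝ (Fin n))) (q : ℝ)
    (y : EuclideanSpace ℝ (Fin n)) : ℝ :=
  (2 * ⨍ x in K, (max (inner ℝ x y) 0) ^ q) ^ (1 / q)

/-- The one-sided `L_q`-centroid body `Z_q^+(K)`: the closed convex set whose support function is
`oneSidedSupportFun K q` (which is sublinear for `q ≥ 1`), written as the intersection of its
supporting half-spaces. -/
def oneSidedCentroidBody {n : ℕ} (K : Set (EuclideanSpace ℝ (Fin n))) (q : ℝ) :
    Set (EuclideanSpace ℝ (Fin n)) :=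
  {x | ∀ y, inner ℝ x y ≤ oneSidedSupportFun K q y}

/-! Write h for the support function of `oneSidedCentroidBody K q` and take q = β log(N/n)/8. The
geometric input is that every half-space {⟨x, y⟩ ≥ t} with 0 ≤ t ≤ h(y)/8 has uniform mass at least
p = 2^(-q-4). By Prékopa–Leindler the tails of ⟨x, y⟩ are midpoint log-concave, so a tail that drops
by a factor ρ over one step keeps dropping at least that fast. Were the mass below p, the tail would
decay geometrically from 0 on and the q-th moment of the positive part would be too small to produce
h(y). This needs a fixed amount of mass on {⟨x, y⟩ ≥ 0}, which centering supplies. The outcome is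
`ConvexBody.two_rpow_le_unif_halfspace`.

The probabilistic input replaces a net of directions by vertices. If the hull misses a point of
Z_q⁺(K)/8, separation gives a y in the polyhedron {y : ⟨x_i, y⟩ ≤ 1 for all i} with F(y) =
(h(y)/8)^q > 1 (`ConvexBody.exists_empty_halfspace`). Since F is convex, some vertex also has F > 1
once the polyhedron is made bounded. A vertex is determined by n constraints, and the remaining
points, at least N - n of them, are independent of it and must all avoid a half-space of mass at
least p. A union bound (`pi_measure_exists_halfspace_le`) gives failure probability at most C(N+2n,
n)(1-p)^(N-n). With r = N/n, p ≥ r^(-β/2), so the power is at most exp(-n r^(1-β/2)/2), which beats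
both the binomial and the target exp(-n r^(1-β)) for large r. -/

open scoped ENNReal NNReal

/-! ### Brunn–Minkowski on the line and Prékopa–Leindler in ℝⁿ -/

/-- One-dimensional Brunn–Minkowski inequality for midpoints. -/
theorem Real.volume_add_volume_le_of_midpoint_mem {A B C : Set ℝ} (hA : MeasurableSet A)
    (hB : MeasurableSet B) (hA₀ : A.Nonempty) (hB₀ : B.Nonempty)
    (h : ∀ x ∈ A, ∀ y ∈ B, midpoint ℝ x y ∈ C) :
    volume A + volume B ≤ 2 * volume C := by
  have key : ∀ K, IsCompact K → K ⊆ A → K.Nonempty → ∀ L, IsCompact L → L ⊆ B → L.Nonempty →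
      volume K + volume L ≤ 2 * volume C := by
    intro K hK hKA hK₀ L hL hLB hL₀
    have ha := hK.sSup_mem hK₀
    have hb := hL.sInf_mem hL₀
    set a := sSup K
    set b := sInf L
    -- With a = max K and b = min L, both translates lie in K + L and meet at most in the point a +
    -- b.
    have h1 : (b +ᵥ K) ∪ (a +ᵥ L) ⊆ (2 : ℝ) • C := by
      rintro z (⟨x, hx, rfl⟩ | ⟨y, hy, rfl⟩)
      · refine ⟨_, h x (hKA hx) b (hLB hb), ?_⟩
        simp [midpoint_eq_smul_add]; ring
      · refine ⟨_, h a (hKA ha) y (hLB hy), ?_⟩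
        simp [midpoint_eq_smul_add]
    have h2 : AEDisjoint volume (b +ᵥ K) (a +ᵥ L) := by
      refine measure_mono_null (t := {a + b}) ?_ (by simp)
      rintro z ⟨⟨x, hx, rfl⟩, ⟨y, hy, hxy⟩⟩
      have hxa : x ≤ a := le_csSup hK.bddAbove hx
      have hyb : b ≤ y := csInf_le hL.bddBelow hy
      simp only [vadd_eq_add, Set.mem_singleton_iff] at hxy ⊢
      linarith
    calc volume K + volume L = volume (b +ᵥ K) + volume (a +ᵥ L) := by
          rw [measure_vadd, measure_vadd]
      _ = volume ((b +ᵥ K) ∪ (a +ᵥ L)) :=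
          (measure_union₀ (hL.measurableSet.const_vadd a).nullMeasurableSet h2).symm
      _ ≤ volume ((2 : ℝ) • C) := measure_mono h1
      _ = 2 * volume C := by simp [Measure.addHaar_smul]
  obtain ⟨a, ha⟩ := hA₀
  obtain ⟨b, hb⟩ := hB₀
  rw [hA.measure_eq_iSup_isCompact, hB.measure_eq_iSup_isCompact]
  simp only [iSup_and']
  refine ENNReal.biSup_add_biSup_le' ⟨∅, by simp⟩ ⟨∅, by simp⟩ ?_
  rintro K ⟨hKA, hK⟩ L ⟨hLB, hL⟩
  -- The compact approximants may be empty; adjoining a point of each set makes the maximum and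
  -- minimum exist.
  refine (add_le_add (measure_mono (Set.subset_insert a K))
    (measure_mono (Set.subset_insert b L))).trans ?_
  exact key _ (hK.insert a) (Set.insert_subset ha hKA) (Set.insert_nonempty _ _)
    _ (hL.insert b) (Set.insert_subset hb hLB) (Set.insert_nonempty _ _)

/-- The Prékopa–Leindler inequality with weights `1/2`, in multiplicative form. -/
def PrekopaLeindler {E : Type*} [MeasurableSpace E] [AddCommGroup E] [Module ℝ E]
    (μ : Measure E) : Prop :=
  ∀ f g h : E → ℝ≥0∞, Measurable f → Measurable g → Measurable h →
    (∀ x y, f x * g y ≤ h (midpoint ℝ x y) ^ 2) →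
    (∫⁻ x, f x ∂μ) * ∫⁻ x, g x ∂μ ≤ (∫⁻ x, h x ∂μ) ^ 2

theorem lintegral_ofReal_eq_setLIntegral_Ioo {f : ℝ → ℝ} (hf : Measurable f)
    (hf₀ : ∀ x, 0 ≤ f x) (hf₁ : ∀ x, f x ≤ 1) :
    ∫⁻ x, ENNReal.ofReal (f x) = ∫⁻ t in Set.Ioo (0 : ℝ) 1, volume {x | t < f x} := by
  rw [lintegral_eq_lintegral_meas_lt _ (Filter.Eventually.of_forall hf₀) hf.aemeasurable,
    ← Set.Ioo_union_Ici_eq_Ioi zero_lt_one,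
    lintegral_union measurableSet_Ici (by
      rw [Set.disjoint_left]; rintro x hx hx'; exact (not_le.2 hx.2) hx')]
  convert add_zero _
  rw [setLIntegral_congr_fun (g := fun _ => 0) measurableSet_Ici]
  · simp
  · intro t ht
    have : {x | t < f x} = ∅ := by
      ext x; simpa using (hf₁ x).trans ht
    simp [this]

/-- One-dimensional Prékopa–Leindler for functions with supremum one, in additive form. -/
theorem lintegral_add_lintegral_le_of_sup_eq_one {f g h : ℝ → ℝ} (hf : Measurable f)
    (hg : Measurable g) (hh : Measurable h) (hf₀ : ∀ x, 0 ≤ f x) (hf₁ : ∀ x, f x ≤ 1)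
    (hg₀ : ∀ x, 0 ≤ g x) (hg₁ : ∀ x, g x ≤ 1) (hh₀ : ∀ x, 0 ≤ h x) (hh₁ : ∀ x, h x ≤ 1)
    (hf' : ∀ t < 1, ∃ x, t < f x) (hg' : ∀ t < 1, ∃ x, t < g x)
    (hfg : ∀ x y, f x * g y ≤ h (midpoint ℝ x y) ^ 2) :
    (∫⁻ x, ENNReal.ofReal (f x)) + ∫⁻ x, ENNReal.ofReal (g x)
      ≤ 2 * ∫⁻ x, ENNReal.ofReal (h x) := by
  rw [lintegral_ofReal_eq_setLIntegral_Ioo hf hf₀ hf₁,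
    lintegral_ofReal_eq_setLIntegral_Ioo hg hg₀ hg₁,
    lintegral_ofReal_eq_setLIntegral_Ioo hh hh₀ hh₁]
  have hanti : ∀ u : ℝ → ℝ, Measurable fun t => volume {x | t < u x} := fun u =>
    Antitone.measurable fun s t hst => measure_mono fun x (hx : t < u x) => hst.trans_lt hx
  rw [← lintegral_add_left (hanti f), ← lintegral_const_mul _ (hanti h)]
  refine setLIntegral_mono ((hanti h).const_mul _) fun t ht => ?_
  refine Real.volume_add_volume_le_of_midpoint_mem (measurableSet_lt measurable_const hf)
    (measurableSet_lt measurable_const hg) (hf' t ht.2) (hg' t ht.2) fun x hx y hy => ?_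
  have hx' : t < f x := hx
  have hy' : t < g y := hy
  have h1 : t ^ 2 < h (midpoint ℝ x y) ^ 2 := by
    refine lt_of_lt_of_le ?_ (hfg x y)
    rw [sq]
    exact mul_lt_mul'' hx' hy' ht.1.le ht.1.le
  exact lt_of_pow_lt_pow_left₀ 2 (hh₀ _) h1

theorem ENNReal.mul_le_sq_of_add_le {a b c : ℝ≥0∞} (h : a + b ≤ 2 * c) : a * b ≤ c ^ 2 := by
  rcases eq_or_ne c ∞ with rfl | hc
  · simp
  have hab : a + b ≠ ∞ := ne_top_of_le_ne_top (ENNReal.mul_ne_top (by simp) hc) h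
  lift a to ℝ≥0 using (ENNReal.add_ne_top.1 hab).1
  lift b to ℝ≥0 using (ENNReal.add_ne_top.1 hab).2
  lift c to ℝ≥0 using hc
  norm_cast at h ⊢
  have h' : (a : ℝ) + b ≤ 2 * c := by exact_mod_cast h
  have : (a : ℝ) * b ≤ c ^ 2 := by
    nlinarith [sq_nonneg ((a : ℝ) - b), a.2, b.2, c.2,
      mul_self_le_mul_self (add_nonneg a.2 b.2) h']
  exact_mod_cast this

/-- Dividing f and g by their suprema a and b, and h by √(ab), reduces to the additive form; AM-GM
then turns the sum into a product. Capping h/√(ab) at 1 is harmless because the normalized product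
never exceeds 1. -/
theorem lintegral_mul_lintegral_le_of_bdd {f g h : ℝ → ℝ≥0∞} (hf : Measurable f)
    (hg : Measurable g) (hh : Measurable h) {R : ℝ≥0} (hfR : ∀ x, f x ≤ R) (hgR : ∀ x, g x ≤ R)
    (hfg : ∀ x y, f x * g y ≤ h (midpoint ℝ x y) ^ 2) :
    (∫⁻ x, f x) * ∫⁻ x, g x ≤ (∫⁻ x, h x) ^ 2 := by
  rcases eq_or_ne (⨆ x, f x) 0 with hf₀ | hf₀
  · have : f = 0 := by funext x; exact le_antisymm ((le_iSup f x).trans hf₀.le) bot_le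
    simp [this]
  rcases eq_or_ne (⨆ x, g x) 0 with hg₀ | hg₀
  · have : g = 0 := by funext x; exact le_antisymm ((le_iSup g x).trans hg₀.le) bot_le
    simp [this]
  obtain ⟨a, ha⟩ : ∃ a : ℝ≥0, ⨆ x, f x = a :=
    ⟨_, (ENNReal.coe_toNNReal (ne_top_of_le_ne_top ENNReal.coe_ne_top (iSup_le hfR))).symm⟩
  obtain ⟨b, hb⟩ : ∃ b : ℝ≥0, ⨆ x, g x = b :=
    ⟨_, (ENNReal.coe_toNNReal (ne_top_of_le_ne_top ENNReal.coe_ne_top (iSup_le hgR))).symm⟩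
  have ha₀ : a ≠ 0 := by rintro rfl; exact hf₀ (by simpa using ha)
  have hb₀ : b ≠ 0 := by rintro rfl; exact hg₀ (by simpa using hb)
  set c : ℝ≥0 := NNReal.sqrt (a * b) with hc
  have hc2 : c ^ 2 = a * b := NNReal.sq_sqrt _
  have hc₀ : c ≠ 0 := by rw [hc]; simp [ha₀, hb₀]
  have hfa : ∀ x, f x / a ≤ 1 := fun x => ENNReal.div_le_of_le_mul (by
    rw [one_mul, ← ha]; exact le_iSup f x)
  have hgb : ∀ x, g x / b ≤ 1 := fun x => ENNReal.div_le_of_le_mul (by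
    rw [one_mul, ← hb]; exact le_iSup g x)
  have hft : ∀ x, f x / a ≠ ∞ := fun x => ne_top_of_le_ne_top (by simp) (hfa x)
  have hgt : ∀ x, g x / b ≠ ∞ := fun x => ne_top_of_le_ne_top (by simp) (hgb x)
  have hht : ∀ x, min (h x / c) 1 ≠ ∞ := fun x => ne_top_of_le_ne_top (by simp) (min_le_right _ 1)
  have key := lintegral_add_lintegral_le_of_sup_eq_one (f := fun x => (f x / a).toReal)
    (g := fun x => (g x / b).toReal) (h := fun x => (min (h x / c) 1).toReal)
    (by fun_prop) (by fun_prop) (by fun_prop)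
    (fun _ => ENNReal.toReal_nonneg)
    (fun x => ENNReal.toReal_le_of_le_ofReal (by simp) (by simpa using hfa x))
    (fun _ => ENNReal.toReal_nonneg)
    (fun x => ENNReal.toReal_le_of_le_ofReal (by simp) (by simpa using hgb x))
    (fun _ => ENNReal.toReal_nonneg) (fun x => ENNReal.toReal_le_of_le_ofReal (by simp) (by simp))
    ?_ ?_ ?_
  · simp only [ENNReal.ofReal_toReal (hft _), ENNReal.ofReal_toReal (hgt _),
      ENNReal.ofReal_toReal (hht _)] at key
    have key2 := ENNReal.mul_le_sq_of_add_le key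
    have e1 : ∫⁻ x, f x = a * ∫⁻ x, f x / a := by
      rw [← lintegral_const_mul _ (by fun_prop)]
      congr 1; funext x
      rw [ENNReal.mul_div_cancel (by simpa using ha₀) (by simp)]
    have e2 : ∫⁻ x, g x = b * ∫⁻ x, g x / b := by
      rw [← lintegral_const_mul _ (by fun_prop)]
      congr 1; funext x
      rw [ENNReal.mul_div_cancel (by simpa using hb₀) (by simp)]
    have e3 : c * ∫⁻ x, min (h x / c) 1 ≤ ∫⁻ x, h x := by
      rw [← lintegral_const_mul _ (by fun_prop)]
      refine lintegral_mono fun x => ?_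
      calc c * min (h x / c) 1 ≤ c * (h x / c) := by gcongr; exact min_le_left _ _
        _ = h x := ENNReal.mul_div_cancel (by simpa using hc₀) (by simp)
    calc (∫⁻ x, f x) * ∫⁻ x, g x = (a * b : ℝ≥0) * ((∫⁻ x, f x / a) * ∫⁻ x, g x / b) := by
          rw [e1, e2, ENNReal.coe_mul]; ring
      _ ≤ (a * b : ℝ≥0) * (∫⁻ x, min (h x / c) 1) ^ 2 := by gcongr
      _ = (c * ∫⁻ x, min (h x / c) 1) ^ 2 := by rw [← hc2, ENNReal.coe_pow]; ring
      _ ≤ _ := by gcongr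
  · intro t ht
    have : (↑(t.toNNReal * a) : ℝ≥0∞) < ⨆ x, f x := by
      rw [ha, ENNReal.coe_lt_coe]
      refine (mul_lt_mul_of_pos_right (b := t.toNNReal) (c := 1) ?_
        (pos_iff_ne_zero.2 ha₀)).trans_eq (one_mul a)
      rw [Real.toNNReal_lt_one]; exact ht
    obtain ⟨x, hx⟩ := lt_iSup_iff.1 this
    refine ⟨x, ?_⟩
    have h2 : (t.toNNReal : ℝ≥0∞) < f x / a := by
      rw [ENNReal.lt_div_iff_mul_lt (by simp [ha₀]) (by simp)]; simpa using hx
    by_contra! h3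
    refine h2.not_ge ?_
    rw [← ENNReal.ofReal_toReal (hft x)]
    exact ENNReal.ofReal_le_ofReal h3
  · intro t ht
    have : (↑(t.toNNReal * b) : ℝ≥0∞) < ⨆ x, g x := by
      rw [hb, ENNReal.coe_lt_coe]
      refine (mul_lt_mul_of_pos_right (b := t.toNNReal) (c := 1) ?_
        (pos_iff_ne_zero.2 hb₀)).trans_eq (one_mul b)
      rw [Real.toNNReal_lt_one]; exact ht
    obtain ⟨x, hx⟩ := lt_iSup_iff.1 this
    refine ⟨x, ?_⟩
    have h2 : (t.toNNReal : ℝ≥0∞) < g x / b := by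
      rw [ENNReal.lt_div_iff_mul_lt (by simp [hb₀]) (by simp)]; simpa using hx
    by_contra! h3
    refine h2.not_ge ?_
    rw [← ENNReal.ofReal_toReal (hgt x)]
    exact ENNReal.ofReal_le_ofReal h3
  · intro x y
    rw [← ENNReal.toReal_mul, ← ENNReal.toReal_pow]
    refine ENNReal.toReal_mono (ENNReal.pow_ne_top (hht _)) ?_
    rcases le_total (h (midpoint ℝ x y) / c) 1 with h1 | h1
    · rw [min_eq_left h1]
      calc f x / a * (g y / b) = f x * g y / (a * b : ℝ≥0) := by
            simp only [div_eq_mul_inv]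
            rw [ENNReal.coe_mul, ENNReal.mul_inv (by simp) (by simp)]; ring
        _ ≤ h (midpoint ℝ x y) ^ 2 / (c ^ 2 : ℝ≥0) := by rw [hc2]; gcongr; exact hfg x y
        _ = (h (midpoint ℝ x y) / c) ^ 2 := by
            simp only [div_eq_mul_inv]
            rw [ENNReal.coe_pow, mul_pow, ENNReal.inv_pow]
    · rw [min_eq_right h1]
      simpa using mul_le_mul' (hfa x) (hgb y)

theorem prekopaLeindler_real : PrekopaLeindler (volume : Measure ℝ) := by
  intro f g h hf hg hh hfg
  have key : ∀ n : ℕ, (∫⁻ x, min (f x) n) * ∫⁻ x, min (g x) n ≤ (∫⁻ x, h x) ^ 2 := fun n =>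
    lintegral_mul_lintegral_le_of_bdd (R := n) (hf.min measurable_const) (hg.min measurable_const)
      hh (fun x => by simp) (fun x => by simp)
      fun x y => (mul_le_mul' (min_le_left _ _) (min_le_left _ _)).trans (hfg x y)
  have hmono : ∀ f : ℝ → ℝ≥0∞, Monotone fun (n : ℕ) x => min (f x) n := fun f m n hmn x =>
    min_le_min le_rfl (by simpa using hmn)
  have hsup : ∀ f : ℝ → ℝ≥0∞, Measurable f → ∫⁻ x, f x = ⨆ n : ℕ, ∫⁻ x, min (f x) n := by
    intro f hf
    rw [← lintegral_iSup (fun n => hf.min measurable_const) (hmono f)]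
    congr 1; funext x
    rw [← inf_iSup_eq, ENNReal.iSup_natCast, inf_top_eq]
  rw [hsup f hf, hsup g hg, ENNReal.iSup_mul]
  refine iSup_le fun i => ?_
  rw [ENNReal.mul_iSup]
  refine iSup_le fun j => (key (max i j)).trans' ?_
  exact mul_le_mul' (lintegral_mono (hmono f (le_max_left i j)))
    (lintegral_mono (hmono g (le_max_right i j)))

/-- The inequality tensorizes: applied on the fibres, it says that the fibre integrals satisfy the
hypothesis on the base. -/
theorem PrekopaLeindler.prod {E F : Type*} [MeasurableSpace E] [AddCommGroup E] [Module ℝ E]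
    [MeasurableSpace F] [AddCommGroup F] [Module ℝ F] {μ : Measure E} {ν : Measure F}
    [SFinite ν] (hμ : PrekopaLeindler μ) (hν : PrekopaLeindler ν) :
    PrekopaLeindler (μ.prod ν) := by
  intro f g h hf hg hh hfg
  rw [lintegral_prod _ hf.aemeasurable, lintegral_prod _ hg.aemeasurable,
    lintegral_prod _ hh.aemeasurable]
  refine hμ _ _ _ hf.lintegral_prod_right' hg.lintegral_prod_right' hh.lintegral_prod_right'
    fun x x' => ?_
  refine hν _ _ _ (by fun_prop) (by fun_prop) (by fun_prop) fun y y' => ?_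
  exact hfg (x, y) (x', y')

theorem PrekopaLeindler.of_measurePreserving {E F : Type*} [MeasurableSpace E] [AddCommGroup E]
    [Module ℝ E] [MeasurableSpace F] [AddCommGroup F] [Module ℝ F] {μ : Measure E} {ν : Measure F}
    (hμ : PrekopaLeindler μ) (e : E → F) (he : MeasurePreserving e μ ν)
    (hmid : ∀ x y, e (midpoint ℝ x y) = midpoint ℝ (e x) (e y)) : PrekopaLeindler ν := by
  intro f g h hf hg hh hfg
  rw [← he.lintegral_comp hf, ← he.lintegral_comp hg, ← he.lintegral_comp hh]
  refine hμ _ _ _ (hf.comp he.measurable) (hg.comp he.measurable) (hh.comp he.measurable)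
    fun x y => ?_
  rw [hmid]
  exact hfg _ _

theorem prekopaLeindler_pi (n : ℕ) : PrekopaLeindler (volume : Measure (Fin n → ℝ)) := by
  induction n with
  | zero =>
    intro f g h _ _ _ hfg
    simp only [lintegral_unique]
    have := hfg default default
    rw [midpoint_self] at this
    have hu : volume (Set.univ : Set (Fin 0 → ℝ)) = 1 := by simp [volume_pi]
    rw [hu, mul_one, mul_one, mul_one]
    convert this
  | succ n ih =>
    refine (prekopaLeindler_real.prod ih).of_measurePreserving _
      (volume_preserving_piFinSuccAbove (fun _ => ℝ) 0).symm fun x y => ?_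
    funext i
    refine Fin.cases ?_ (fun j => ?_) i <;>
      simp [MeasurableEquiv.piFinSuccAbove, midpoint_eq_smul_add, mul_add]

theorem prekopaLeindler_euclideanSpace (n : ℕ) :
    PrekopaLeindler (volume : Measure (EuclideanSpace ℝ (Fin n))) :=
  (prekopaLeindler_pi n).of_measurePreserving _ (PiLp.volume_preserving_toLp (Fin n)) fun x y => by
    simp [midpoint_eq_smul_add]

theorem PrekopaLeindler.measure_mul_measure_le {E : Type*} [MeasurableSpace E] [AddCommGroup E]
    [Module ℝ E] {μ : Measure E} (hμ : PrekopaLeindler μ) {A B C : Set E} (hA : MeasurableSet A)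
    (hB : MeasurableSet B) (hC : MeasurableSet C)
    (h : ∀ x ∈ A, ∀ y ∈ B, midpoint ℝ x y ∈ C) : μ A * μ B ≤ μ C ^ 2 := by
  rw [← lintegral_indicator_one hA, ← lintegral_indicator_one hB, ← lintegral_indicator_one hC]
  refine hμ _ _ _ (measurable_one.indicator hA) (measurable_one.indicator hB)
    (measurable_one.indicator hC) fun x y => ?_
  by_cases hx : x ∈ A <;> by_cases hy : y ∈ B <;> simp [hx, hy, h]

/-! ### Tails and moments of centered log-concave measures on the line -/

/-- A midpoint log-concave non-increasing function decays geometrically along an arithmetic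
progression, at the rate of its first step. -/
theorem Antitone.le_mul_of_midpoint_logConcave {G : ℝ → ℝ} (hG : Antitone G) (hG₀ : ∀ t, 0 ≤ G t)
    (hlc : ∀ s t, G s * G t ≤ G ((s + t) / 2) ^ 2) {b t ρ : ℝ} (ht : 0 ≤ t) (hρ : 0 ≤ ρ)
    (h : G (b + t) ≤ ρ * G b) (k : ℕ) : G (b + (k + 1) * t) ≤ ρ * G (b + k * t) := by
  induction k with
  | zero => simpa using h
  | succ k ih =>
    push_cast
    have h1 := hlc (b + k * t) (b + (k + 1 + 1) * t)
    rw [show (b + k * t + (b + (k + 1 + 1) * t)) / 2 = b + (k + 1) * t by ring] at h1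
    have hk : G (b + (k + 1 + 1) * t) ≤ G (b + k * t) := hG (by nlinarith)
    rcases (hG₀ (b + k * t)).eq_or_lt with h0 | h0
    · rw [← h0] at hk
      exact hk.trans (mul_nonneg hρ (hG₀ _))
    · refine le_of_mul_le_mul_left ?_ h0
      have h2 := mul_le_mul_of_nonneg_left ih (hG₀ (b + (k + 1) * t))
      nlinarith

theorem Antitone.le_pow_mul_of_midpoint_logConcave {G : ℝ → ℝ} (hG : Antitone G)
    (hG₀ : ∀ t, 0 ≤ G t) (hlc : ∀ s t, G s * G t ≤ G ((s + t) / 2) ^ 2) {b t ρ : ℝ} (ht : 0 ≤ t)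
    (hρ : 0 ≤ ρ) (h : G (b + t) ≤ ρ * G b) (m k : ℕ) :
    G (b + (m + k) * t) ≤ ρ ^ k * G (b + m * t) := by
  induction k with
  | zero => simp
  | succ k ih =>
    have := hG.le_mul_of_midpoint_logConcave hG₀ hlc ht hρ h (m + k)
    push_cast at this ⊢
    rw [← add_assoc, pow_succ', mul_assoc]
    exact this.trans (mul_le_mul_of_nonneg_left ih hρ)

/-- Geometric decay of the tails along an arithmetic progression bounds the one-sided moments. -/
theorem integral_max_rpow_le_of_geometric_tail {ν : Measure ℝ} [IsFiniteMeasure ν] {q t ρ : ℝ}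
    (hq : 0 < q) (ht : 0 < t) (hρ : 0 ≤ ρ) (hqρ : 2 ^ q * ρ ≤ 1 / 2)
    (hk : ∀ k : ℕ, ν.real (Set.Ici (k * t)) ≤ ρ ^ k * ν.real (Set.Ici 0)) :
    ∫ x, max x 0 ^ q ∂ν ≤ 2 * t ^ q * ν.real (Set.Ici 0) := by
  rw [integral_eq_lintegral_of_nonneg_ae (Filter.Eventually.of_forall fun x => by positivity)
    ((measurable_id'.max measurable_const).pow_const q).aestronglyMeasurable]
  refine ENNReal.toReal_le_of_le_ofReal (by positivity) ?_
  calc ∫⁻ x, ENNReal.ofReal (max x 0 ^ q) ∂ν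
      ≤ ∫⁻ x, ∑' k : ℕ, (Set.Ici (k * t)).indicator
          (fun _ => ENNReal.ofReal (((k + 1) * t) ^ q)) x ∂ν := by
        refine lintegral_mono fun x => ?_
        rcases lt_or_ge x 0 with hx | hx
        · simp [max_eq_right hx.le, Real.zero_rpow hq.ne']
        · refine le_trans ?_ (ENNReal.le_tsum ⌊x / t⌋₊)
          rw [Set.indicator_of_mem, max_eq_left hx]
          · refine ENNReal.ofReal_le_ofReal (Real.rpow_le_rpow hx ?_ hq.le)
            rw [← div_le_iff₀ ht]
            exact (Nat.lt_floor_add_one _).le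
          · rw [Set.mem_Ici, ← le_div_iff₀ ht]
            exact Nat.floor_le (by positivity)
    _ = ∑' k : ℕ, ENNReal.ofReal (((k + 1) * t) ^ q) * ν (Set.Ici (k * t)) := by
        rw [lintegral_tsum fun k =>
          (measurable_const.indicator measurableSet_Ici).aemeasurable]
        simp [lintegral_indicator_const measurableSet_Ici]
    _ ≤ ∑' k : ℕ, ENNReal.ofReal (t ^ q * ν.real (Set.Ici 0) * (1 / 2) ^ k) := by
        refine ENNReal.tsum_le_tsum fun k => ?_
        rw [← ofReal_measureReal, ← ENNReal.ofReal_mul (by positivity)]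
        refine ENNReal.ofReal_le_ofReal ?_
        -- This crude bound absorbs the polynomial factor: (k+1)^q ρ^k ≤ (2^q ρ)^k ≤ 2^(-k).
        have h2 : ((k : ℝ) + 1) ≤ 2 ^ k := by exact_mod_cast Nat.lt_two_pow_self (n := k)
        have h3 : ((k : ℝ) + 1) ^ q ≤ (2 ^ q) ^ k := by
          refine (Real.rpow_le_rpow (by positivity) h2 hq.le).trans_eq ?_
          rw [← Real.rpow_natCast, ← Real.rpow_natCast, ← Real.rpow_mul (by norm_num),
            ← Real.rpow_mul (by norm_num), mul_comm]
        calc ((k + 1) * t) ^ q * ν.real (Set.Ici (k * t))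
            ≤ ((2 ^ q) ^ k * t ^ q) * (ρ ^ k * ν.real (Set.Ici 0)) := by
              rw [Real.mul_rpow (by positivity) ht.le]
              gcongr
              exact hk k
          _ = t ^ q * ν.real (Set.Ici 0) * (2 ^ q * ρ) ^ k := by rw [mul_pow]; ring
          _ ≤ _ := by gcongr
    _ = ENNReal.ofReal (2 * t ^ q * ν.real (Set.Ici 0)) := by
        rw [← ENNReal.ofReal_tsum_of_nonneg (fun k => by positivity)
          (summable_geometric_two.mul_left _), tsum_mul_left, tsum_geometric_two]
        congr 1; ring

theorem measureReal_Ici_antitone {ν : Measure ℝ} [IsFiniteMeasure ν] :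
    Antitone fun t => ν.real (Set.Ici t) := fun _ _ h =>
  measureReal_mono (Set.Ici_subset_Ici.2 h)

/-- A centered log-concave random variable is non-negative with probability at least `1/8`. -/
theorem one_div_eight_le_measureReal_Ici_zero {ν : Measure ℝ} [IsProbabilityMeasure ν]
    (hlc : ∀ s t, ν.real (Set.Ici s) * ν.real (Set.Ici t) ≤ ν.real (Set.Ici ((s + t) / 2)) ^ 2)
    (hint : Integrable (fun x => x) ν) (hmean : ∫ x, x ∂ν = 0) :
    1 / 8 ≤ ν.real (Set.Ici 0) := by
  by_contra! hlt
  have hIio : 1 / 2 < ν.real (Set.Iio 0) := by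
    have := probReal_add_probReal_compl (μ := ν) (measurableSet_Ici (a := (0 : ℝ)))
    rw [Set.compl_Ici] at this
    linarith
  set S := {u : ℝ | 1 / 2 ≤ ν.real (Set.Iic (-u))} with hS
  obtain ⟨u₀, hu₀, hu₀S⟩ : ∃ u₀ > 0, u₀ ∈ S := by
    have hU : Set.Iio (0 : ℝ) = ⋃ n : ℕ, Set.Iic (-(1 / ((n : ℝ) + 1))) := by
      ext x
      simp only [Set.mem_Iio, Set.mem_iUnion, Set.mem_Iic]
      constructor
      · intro hx
        obtain ⟨n, hn⟩ := exists_nat_one_div_lt (neg_pos.2 hx)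
        exact ⟨n, by linarith⟩
      · rintro ⟨n, hn⟩
        have : 0 < 1 / ((n : ℝ) + 1) := by positivity
        linarith
    have hmono : Monotone fun n : ℕ => Set.Iic (-(1 / ((n : ℝ) + 1))) := by
      intro m n hmn
      refine Set.Iic_subset_Iic.2 (neg_le_neg ?_)
      exact one_div_le_one_div_of_le (by positivity) (by exact_mod_cast Nat.succ_le_succ hmn)
    have ht := tendsto_measure_iUnion_atTop (μ := ν) hmono
    rw [← hU] at ht
    have ht' := (ENNReal.tendsto_toReal (measure_ne_top ν _)).comp ht
    obtain ⟨n, hn⟩ := (ht'.eventually (lt_mem_nhds hIio)).exists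
    exact ⟨1 / ((n : ℝ) + 1), by positivity, hn.le⟩
  have hbdd : BddAbove S := by
    obtain ⟨a, ha⟩ := ((tendsto_cdf_atBot ν).eventually
      (gt_mem_nhds (by norm_num : (0 : ℝ) < 1 / 2))).exists
    rw [cdf_eq_real] at ha
    refine ⟨-a, fun u hu => ?_⟩
    by_contra! hau
    have h1 : ν.real (Set.Iic (-u)) ≤ ν.real (Set.Iic a) :=
      measureReal_mono (Set.Iic_subset_Iic.2 (by linarith))
    have h2 : ν.real (Set.Iic a) < 1 / 2 := ha
    have h3 : 1 / 2 ≤ ν.real (Set.Iic (-u)) := hu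
    linarith
  have hpos : 0 < sSup S := hu₀.trans_le (le_csSup hbdd hu₀S)
  -- Such a u lies in S while 2u does not, so half the mass is left of -u and half is right of -2u.
  -- Between -2u and 0 the tail falls by a factor 4, hence E X₊ ≤ 4u · ν[0,∞) < u/2, whereas E X₋ ≥
  -- u/2 by Markov; a zero mean forbids this.
  obtain ⟨u, huS, hu⟩ := exists_lt_of_lt_csSup ⟨u₀, hu₀S⟩ (half_lt_self hpos)
  have hu0 : 0 < u := (half_pos hpos).trans hu
  have h2u : ν.real (Set.Iic (-(2 * u))) < 1 / 2 := by
    by_contra! h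
    have := le_csSup hbdd (show 2 * u ∈ S from h)
    linarith
  have hG2 : 1 / 2 ≤ ν.real (Set.Ici (-(2 * u))) := by
    have := probReal_add_probReal_compl (μ := ν) (measurableSet_Ici (a := -(2 * u)))
    rw [Set.compl_Ici] at this
    have h3 : ν.real (Set.Iio (-(2 * u))) ≤ ν.real (Set.Iic (-(2 * u))) :=
      measureReal_mono Set.Iio_subset_Iic_self
    linarith
  have hgeo := (measureReal_Ici_antitone (ν := ν)).le_pow_mul_of_midpoint_logConcave
    (fun t => measureReal_nonneg) hlc (b := -(2 * u)) (t := 2 * u) (ρ := 1 / 4) (by positivity)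
    (by norm_num) (by simp only [neg_add_cancel]; linarith) 1
  have hM := integral_max_rpow_le_of_geometric_tail (ν := ν) (q := 1) (t := 2 * u) (ρ := 1 / 4)
    (by norm_num) (by positivity) (by norm_num) (by norm_num) fun k => by
      have := hgeo k
      simp only [Nat.cast_one, one_mul, neg_add_cancel] at this
      convert this using 3
      ring
  simp only [Real.rpow_one] at hM
  have hneg : ∫ x, max x 0 ∂ν = ∫ x, max (-x) 0 ∂ν := by
    rw [← sub_eq_zero, ← integral_sub hint.pos_part hint.neg_part]
    refine Eq.trans (integral_congr_ae (Filter.Eventually.of_forall fun x => ?_)) hmean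
    dsimp only
    rcases le_total x 0 with h | h
    · rw [max_eq_right h, max_eq_left (by linarith)]; ring
    · rw [max_eq_left h, max_eq_right (by linarith)]; ring
  have hmarkov := mul_meas_ge_le_integral_of_nonneg (μ := ν) (f := fun x => max (-x) 0)
    (Filter.Eventually.of_forall fun x => le_max_right _ _) hint.neg_part u
  have hset : {x : ℝ | u ≤ max (-x) 0} = Set.Iic (-u) := by
    ext x
    simp only [Set.mem_ofPred_eq, le_max_iff, Set.mem_Iic]
    constructor
    · rintro (h | h) <;> linarith
    · intro h; left; linarith
  rw [hset] at hmarkov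
  have huS' : 1 / 2 ≤ ν.real (Set.Iic (-u)) := huS
  change u * ν.real _ ≤ _ at hmarkov
  nlinarith

/-- Lower bound for the mass of the half-lines reaching a fixed fraction of the one-sided `q`-th
moment of a centered log-concave random variable. -/
theorem two_rpow_le_measureReal_Ici {ν : Measure ℝ} [IsProbabilityMeasure ν]
    (hlc : ∀ s t, ν.real (Set.Ici s) * ν.real (Set.Ici t) ≤ ν.real (Set.Ici ((s + t) / 2)) ^ 2)
    (hint : Integrable (fun x => x) ν) (hmean : ∫ x, x ∂ν = 0) {q t : ℝ} (hq : 1 ≤ q) (ht : 0 ≤ t)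
    (h : (8 * t) ^ q ≤ 2 * ∫ x, max x 0 ^ q ∂ν) :
    (2 : ℝ) ^ (-q - 4) ≤ ν.real (Set.Ici t) := by
  have h0 := one_div_eight_le_measureReal_Ici_zero hlc hint hmean
  have e3 : (2 : ℝ) ^ (-q - 4) = 2 ^ (-q - 1) * (1 / 8) := by
    rw [show -q - 4 = (-q - 1) + (-3) by ring, Real.rpow_add (by norm_num)]
    norm_num [Real.rpow_neg]
  rcases ht.eq_or_lt with rfl | ht
  · refine le_trans ?_ h0
    rw [e3]
    have : (2 : ℝ) ^ (-q - 1) ≤ 1 :=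
      Real.rpow_le_one_of_one_le_of_nonpos (by norm_num) (by linarith)
    linarith
  by_contra! hlt
  have hρ : 0 < (2 : ℝ) ^ (-q - 1) := by positivity
  -- The ratio 2^(-q-1) is exactly what makes 2^q ρ = 1/2; the remaining 2^(-3) in the bound pays
  -- for the mass 1/8 at 0. The moment is then at most 2t^q, against the assumed lower bound 8^q t^q
  -- / 2.
  have hgeo := (measureReal_Ici_antitone (ν := ν)).le_pow_mul_of_midpoint_logConcave
    (fun t => measureReal_nonneg) hlc (b := 0) (t := t) ht.le hρ.le
    (by simp only [zero_add]; rw [e3] at hlt; nlinarith) 0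
  have hM := integral_max_rpow_le_of_geometric_tail (ν := ν) (by linarith : 0 < q) ht hρ.le
    (by rw [← Real.rpow_add (by norm_num)]; ring_nf; norm_num [Real.rpow_neg]) fun k => by
      simpa using hgeo k
  have h1 : ν.real (Set.Ici 0) ≤ 1 := measureReal_le_one
  have h8 : (8 : ℝ) ≤ 8 ^ q := Real.self_le_rpow_of_one_le (by norm_num) hq
  have htq : 0 < t ^ q := by positivity
  rw [Real.mul_rpow (by norm_num) ht.le] at h
  nlinarith

/-! ### Vertices of polyhedra as solutions of linear systems -/

/-- At an extreme point of a polyhedron the normals of the active constraints span the space. -/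
theorem span_active_eq_top_of_mem_extremePoints {E ι : Type*} [NormedAddCommGroup E]
    [InnerProductSpace ℝ E] [FiniteDimensional ℝ E] [Finite ι] {v : ι → E} {y : E}
    (hy : y ∈ Set.extremePoints ℝ {y : E | ∀ i, inner ℝ (v i) y ≤ 1}) :
    Submodule.span ℝ (Set.range fun i : {i // inner ℝ (v i) y = 1} => v i) = ⊤ := by
  by_contra hne
  rw [← Submodule.orthogonal_eq_bot_iff] at hne
  -- Moving along ±u leaves active constraints tight and, for small steps, inactive ones satisfied,
  -- so y would be the midpoint of a segment in the polyhedron.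
  obtain ⟨u, hu, hu0⟩ := Submodule.exists_mem_ne_zero_of_ne_bot hne
  have htight : ∀ i, inner ℝ (v i) y = 1 → inner ℝ (v i) u = 0 := fun i hi =>
    (Submodule.mem_orthogonal _ _).1 hu _ (Submodule.subset_span ⟨⟨i, hi⟩, rfl⟩)
  have hev : ∀ᶠ t : ℝ in nhds 0, ∀ i, inner ℝ (v i) (y + t • u) ≤ 1 := by
    rw [Filter.eventually_all]
    intro i
    rcases (hy.1 i).eq_or_lt with h | h
    · refine Filter.Eventually.of_forall fun t => ?_
      rw [inner_add_right, inner_smul_right, htight i h, h]; simp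
    · have hc : Continuous fun t : ℝ => inner ℝ (v i) (y + t • u) := by fun_prop
      have := hc.tendsto 0
      simp only [zero_smul, add_zero] at this
      exact (this.eventually (gt_mem_nhds h)).mono fun t ht => ht.le
  have hev' : ∀ᶠ t : ℝ in nhds 0, ∀ i, inner ℝ (v i) (y + (-t) • u) ≤ 1 := by
    have h0 : Filter.Tendsto (fun t : ℝ => -t) (nhds 0) (nhds 0) := by
      simpa using (continuous_neg (G := ℝ)).tendsto 0
    exact h0.eventually hev
  obtain ⟨t, ⟨h1, h2⟩, ht⟩ := (((hev.and hev').filter_mono nhdsWithin_le_nhds).and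
    (self_mem_nhdsWithin (s := {0}ᶜ))).exists
  have hmem : y ∈ openSegment ℝ (y + t • u) (y + (-t) • u) :=
    ⟨1 / 2, 1 / 2, by norm_num, by norm_num, by norm_num, by module⟩
  have := hy.2 h1 h2 hmem
  rw [add_eq_left, smul_eq_zero] at this
  exact this.elim ht hu0

theorem exists_finset_active_of_mem_extremePoints {E ι : Type*} [NormedAddCommGroup E]
    [InnerProductSpace ℝ E] [FiniteDimensional ℝ E] [Finite ι] {v : ι → E} {y : E}
    (hy : y ∈ Set.extremePoints ℝ {y : E | ∀ i, inner ℝ (v i) y ≤ 1}) :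
    ∃ s : Finset ι, s.card = Module.finrank ℝ E ∧ LinearIndependent ℝ (fun i : s => v i) ∧
      ∀ i ∈ s, inner ℝ (v i) y = 1 := by
  classical
  obtain ⟨κ, a, ha, hspan, hli⟩ :=
    exists_linearIndependent' ℝ (fun i : {i // inner ℝ (v i) y = 1} => v i)
  rw [span_active_eq_top_of_mem_extremePoints hy] at hspan
  have : Finite κ := Finite.of_injective a ha
  have := Fintype.ofFinite κ
  have hcard := Module.finrank_eq_card_basis (Module.Basis.mk hli hspan.ge)
  let a' : κ ↪ ι := ⟨fun k => a k, Subtype.val_injective.comp ha⟩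
  refine ⟨Finset.univ.map a', by simp [hcard], ?_, ?_⟩
  · have hex : ∀ i : (Finset.univ.map a' : Finset ι), ∃ k, a' k = i := fun i => by
      obtain ⟨k, -, hk⟩ := Finset.mem_map.1 i.2
      exact ⟨k, hk⟩
    choose g hg using hex
    have hginj : Function.Injective g := fun i j hij => by
      rw [Subtype.ext_iff, ← hg, ← hg, hij]
    have hvg : (fun i : (Finset.univ.map a' : Finset ι) => v i)
        = ((fun i : {i // inner ℝ (v i) y = 1} => v i) ∘ a) ∘ g :=
      funext fun i => congrArg v (hg i).symm
    rw [hvg]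
    exact hli.comp g hginj
  · intro i hi
    obtain ⟨k, -, rfl⟩ := Finset.mem_map.1 hi
    exact (a k).2

/-- A convex function exceeding a level on a bounded polyhedron exceeds it at a vertex. -/
theorem exists_extremePoint_lt {E : Type*} [NormedAddCommGroup E] [NormedSpace ℝ E]
    {P : Set E} (hP : IsCompact P) (hPc : Convex ℝ P) {F : E → ℝ} (hF : ConvexOn ℝ Set.univ F)
    (hFc : Continuous F) {c : ℝ} {y : E} (hy : y ∈ P) (hc : c < F y) :
    ∃ z ∈ Set.extremePoints ℝ P, c < F z := by
  by_contra! h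
  have hconv : Convex ℝ {z | F z ≤ c} := by
    simpa using hF.convex_le c
  have hclosed : IsClosed {z | F z ≤ c} := isClosed_le hFc continuous_const
  have hsub : closure (convexHull ℝ (Set.extremePoints ℝ P)) ⊆ {z | F z ≤ c} :=
    closure_minimal (convexHull_min h hconv) hclosed
  rw [closure_convexHull_extremePoints hP hPc] at hsub
  exact hc.not_ge (hsub hy)

/-- The solution `y` of the linear system `⟪w k, y⟫ = 1`, given by the inverse matrix. -/
noncomputable def systemSolution {n : ℕ} (w : Fin n → EuclideanSpace ℝ (Fin n)) :
    EuclideanSpace ℝ (Fin n) :=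
  WithLp.toLp 2 (Matrix.mulVec (Matrix.of fun k j => w k j)⁻¹ 1)

theorem eq_systemSolution {n : ℕ} {w : Fin n → EuclideanSpace ℝ (Fin n)}
    (hw : LinearIndependent ℝ w) {y : EuclideanSpace ℝ (Fin n)} (hy : ∀ k, inner ℝ (w k) y = 1) :
    y = systemSolution w := by
  set A : Matrix (Fin n) (Fin n) ℝ := Matrix.of fun k j => w k j with hA
  have hrow : LinearIndependent ℝ A.row := by
    exact hw.map' (WithLp.linearEquiv 2 ℝ (Fin n → ℝ)).toLinearMap (LinearEquiv.ker _)
  have hunit : IsUnit A := Matrix.linearIndependent_rows_iff_isUnit.1 hrow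
  have h1 : A.mulVec y.ofLp = 1 := by
    funext k
    rw [Pi.one_apply, ← hy k]
    simp [Matrix.mulVec, dotProduct, hA, PiLp.inner_apply, mul_comm]
  unfold systemSolution
  rw [← hA, ← h1, Matrix.mulVec_mulVec,
    Matrix.nonsing_inv_mul _ ((Matrix.isUnit_iff_isUnit_det A).1 hunit),
    Matrix.one_mulVec]

/-- Cramer's rule: each coordinate is a sum of cofactors over the determinant. Singular systems
cause no trouble, since real inversion with 0⁻¹ = 0 is measurable. -/
theorem measurable_systemSolution {n : ℕ} :
    Measurable (systemSolution : (Fin n → EuclideanSpace ℝ (Fin n)) → _) := by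
  refine (WithLp.measurable_toLp 2 _).comp (measurable_pi_lambda _ fun i => ?_)
  have hc : Continuous fun w : Fin n → EuclideanSpace ℝ (Fin n) =>
      (Matrix.of fun k j => w k j : Matrix (Fin n) (Fin n) ℝ) :=
    continuous_matrix fun k j => by simp only [Matrix.of_apply]; fun_prop
  simp only [Matrix.mulVec, dotProduct, Matrix.inv_def, Matrix.smul_apply, Ring.inverse_eq_inv',
    smul_eq_mul, Pi.one_apply, mul_one]
  refine Finset.measurable_sum _ fun j _ => ?_
  exact (hc.matrix_det.measurable.inv).mul (hc.matrix_adjugate.matrix_elem i j).measurable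

/-! ### Union bound over the vertices of the random polar polyhedron -/

/-- If `y` is determined by the points with indices in `t`, then the other points all lie in a
half-space determined by `y` with small probability. -/
theorem pi_measure_halfspace_le {E ι : Type*} [NormedAddCommGroup E]
    [InnerProductSpace ℝ E] [MeasurableSpace E] [BorelSpace E] [SecondCountableTopology E]
    [Fintype ι] (μ : Measure E) [IsProbabilityMeasure μ] (t : Finset ι) {Y : (ι → E) → E}
    (hY : Measurable Y) (hYt : DependsOn Y t) {A : Set E} (hA : MeasurableSet A) {r : ℝ≥0∞}
    (hr : ∀ y ∈ A, μ {x | inner ℝ x y ≤ 1} ≤ r) :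
    Measure.pi (fun _ : ι => μ) {x | Y x ∈ A ∧ ∀ i, inner ℝ (x i) (Y x) ≤ 1}
      ≤ r ^ (Fintype.card ι - t.card) := by
  classical
  set B := {x : ι → E | Y x ∈ A ∧ ∀ i, i ∉ t → inner ℝ (x i) (Y x) ≤ 1} with hB
  have hBm : MeasurableSet B := by
    refine (hY hA).inter ?_
    have : {x : ι → E | ∀ i, i ∉ t → inner ℝ (x i) (Y x) ≤ 1}
        = ⋂ i, ⋂ (_ : i ∉ t), {x | inner ℝ (x i) (Y x) ≤ 1} := by ext; simp
    change MeasurableSet {x : ι → E | ∀ i, i ∉ t → inner ℝ (x i) (Y x) ≤ 1}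
    rw [this]
    exact MeasurableSet.iInter fun i => MeasurableSet.iInter fun _ =>
      measurableSet_le ((measurable_pi_apply i).inner hY) measurable_const
  -- Keep only the constraints outside t and apply Fubini: with the t-coordinates frozen, y is
  -- constant and the other points are independent.
  refine (measure_mono (t := B) fun x hx => ⟨hx.1, fun i _ => hx.2 i⟩).trans ?_
  have hmp := (measurePreserving_piEquivPiSubtypeProd (fun _ : ι => μ) (fun i => i ∈ t)).symm
  rw [← hmp.measure_preimage hBm.nullMeasurableSet, Measure.prod_apply (hmp.measurable hBm)]
  refine (lintegral_mono (g := fun _ => r ^ (Fintype.card ι - t.card)) fun a => ?_).trans (by simp)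
  set e := (MeasurableEquiv.piEquivPiSubtypeProd (fun _ : ι => E) (fun i => i ∈ t)).symm with he
  have hag : ∀ b b', Y (e (a, b)) = Y (e (a, b')) := fun b b' => hYt fun i hi => by
    have : i ∈ t := hi
    simp [he, MeasurableEquiv.piEquivPiSubtypeProd, Equiv.piEquivPiSubtypeProd, this]
  set y := Y (e (a, fun _ => 0)) with hy
  by_cases hyA : y ∈ A
  · calc _ ≤ Measure.pi (fun _ : {i // ¬ i ∈ t} => μ)
          (Set.pi Set.univ fun _ => {x | inner ℝ x y ≤ 1}) := by
          refine measure_mono fun b hb i _ => ?_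
          have h : inner ℝ (e (a, b) i) (Y (e (a, b))) ≤ 1 := hb.2 i i.2
          have hbi : e (a, b) i = b i := by
            simp [he, MeasurableEquiv.piEquivPiSubtypeProd, Equiv.piEquivPiSubtypeProd, i.2]
          rwa [hag b (fun _ => 0), hbi] at h
      _ = μ {x | inner ℝ x y ≤ 1} ^ (Fintype.card ι - t.card) := by
          rw [Measure.pi_pi, Finset.prod_const, Finset.card_univ, Fintype.card_subtype_compl]
          simp
      _ ≤ _ := pow_le_pow_left' (hr y hyA) _
  · refine (measure_mono_null (t := ∅) (fun b hb => ?_) (by simp)).trans_le bot_le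
    have := hb.1
    rw [hag b (fun _ => 0)] at this
    exact hyA this

/-- The given points together with the `2n` points `±(m+1)⁻¹ eⱼ`. -/
noncomputable def withSmallCross {n N : ℕ} (m : ℕ) (x : Fin N → EuclideanSpace ℝ (Fin n)) :
    Fin N ⊕ (Fin n ⊕ Fin n) → EuclideanSpace ℝ (Fin n) :=
  Sum.elim x (Sum.elim (fun j => EuclideanSpace.single j ((m : ℝ) + 1)⁻¹)
    (fun j => EuclideanSpace.single j (-((m : ℝ) + 1)⁻¹)))

theorem forall_inner_withSmallCross_le {n N : ℕ} {m : ℕ} {x : Fin N → EuclideanSpace ℝ (Fin n)}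
    {y : EuclideanSpace ℝ (Fin n)} :
    (∀ i, inner ℝ (withSmallCross m x i) y ≤ 1) ↔
      (∀ i, inner ℝ (x i) y ≤ 1) ∧ ∀ j, |y j| ≤ m + 1 := by
  have hm : (0 : ℝ) < m + 1 := by positivity
  simp only [withSmallCross, Sum.forall, Sum.elim_inl, Sum.elim_inr,
    EuclideanSpace.inner_single_left, abs_le]
  refine and_congr_right fun _ => ?_
  rw [← forall_and]
  refine forall_congr' fun j => ?_
  simp only [map_neg, conj_trivial, neg_mul, inv_mul_le_iff₀ hm]
  rw [neg_le, le_inv_mul_iff₀ hm, and_comm]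
  simp

theorem isCompact_setOf_inner_withSmallCross_le {n N : ℕ} (m : ℕ)
    (x : Fin N → EuclideanSpace ℝ (Fin n)) :
    IsCompact {y | ∀ i, inner ℝ (withSmallCross m x i) y ≤ 1} := by
  have hK : IsCompact (WithLp.toLp 2 '' (Set.pi Set.univ fun _ : Fin n =>
      Set.Icc (-((m : ℝ) + 1)) (m + 1))) :=
    (isCompact_univ_pi fun _ => isCompact_Icc).image (PiLp.continuous_toLp 2 _)
  refine hK.of_isClosed_subset ?_ fun y hy => ?_
  · have : {y | ∀ i, inner ℝ (withSmallCross m x i) y ≤ 1}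
        = ⋂ i, {y | inner ℝ (withSmallCross m x i) y ≤ 1} := by ext; simp
    rw [this]
    exact isClosed_iInter fun i => isClosed_le (by fun_prop) continuous_const
  · exact ⟨y.ofLp, fun j _ => abs_le.1 ((forall_inner_withSmallCross_le.1 hy).2 j), rfl⟩

theorem convex_setOf_inner_le {E ι : Type*} [NormedAddCommGroup E] [InnerProductSpace ℝ E]
    (v : ι → E) : Convex ℝ {y | ∀ i, inner ℝ (v i) y ≤ 1} := by
  intro y hy z hz a b ha hb hab i
  rw [inner_add_right, inner_smul_right, inner_smul_right]
  calc a * inner ℝ (v i) y + b * inner ℝ (v i) z ≤ a * 1 + b * 1 := by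
        gcongr
        · exact hy i
        · exact hz i
    _ = 1 := by linarith

/-- Union bound over the vertices of the polar polytope of random points. -/
theorem pi_measure_exists_halfspace_le {n : ℕ} (μ : Measure (EuclideanSpace ℝ (Fin n)))
    [IsProbabilityMeasure μ] {F : EuclideanSpace ℝ (Fin n) → ℝ} (hF : ConvexOn ℝ Set.univ F)
    (hFc : Continuous F) {r : ℝ≥0∞} (hr1 : r ≤ 1)
    (hr : ∀ y, 1 < F y → μ {x | inner ℝ x y ≤ 1} ≤ r) (N : ℕ) :
    Measure.pi (fun _ : Fin N => μ) {x | ∃ y, 1 < F y ∧ ∀ i, inner ℝ (x i) y ≤ 1}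
      ≤ (N + 2 * n).choose n * r ^ (N - n) := by
  -- The cross points confine y to the box |y_j| ≤ m + 1, making the polyhedron compact. The events
  -- increase with m and the bound does not depend on m, so the box can be removed in the limit.
  set D : ℕ → Set (Fin N → EuclideanSpace ℝ (Fin n)) := fun m =>
    {x | ∃ y, 1 < F y ∧ ∀ i, inner ℝ (withSmallCross m x i) y ≤ 1} with hD
  have hDU : {x : Fin N → EuclideanSpace ℝ (Fin n) | ∃ y, 1 < F y ∧ ∀ i, inner ℝ (x i) y ≤ 1}
      ⊆ ⋃ m, D m := by
    rintro x ⟨y, hy, hx⟩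
    obtain ⟨m, hm⟩ := exists_nat_ge (∑ j, |y j|)
    refine Set.mem_iUnion.2 ⟨m, y, hy, forall_inner_withSmallCross_le.2 ⟨hx, fun j => ?_⟩⟩
    have := Finset.single_le_sum (f := fun j => |y j|) (fun j _ => abs_nonneg _)
      (Finset.mem_univ j)
    dsimp only at this
    linarith
  have hDm : Monotone D := by
    rintro m k hmk x ⟨y, hy, hx⟩
    rw [forall_inner_withSmallCross_le] at hx
    refine ⟨y, hy, forall_inner_withSmallCross_le.2 ⟨hx.1, fun j => (hx.2 j).trans ?_⟩⟩
    gcongr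
  refine (measure_mono hDU).trans ?_
  rw [hDm.measure_iUnion]
  refine iSup_le fun m => ?_
  let idx : ∀ s : Finset (Fin N ⊕ (Fin n ⊕ Fin n)), s.card = n → Fin n → s := fun s hs =>
    (Finset.equivFinOfCardEq hs).symm
  let Y : ∀ s : Finset (Fin N ⊕ (Fin n ⊕ Fin n)), s.card = n →
      (Fin N → EuclideanSpace ℝ (Fin n)) → EuclideanSpace ℝ (Fin n) := fun s hs x =>
    systemSolution fun k => withSmallCross m x (idx s hs k)
  have hsub : D m ⊆ ⋃ s ∈ (Finset.powersetCard n Finset.univ :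
      Finset (Finset (Fin N ⊕ (Fin n ⊕ Fin n)))),
      {x | ∃ hs : s.card = n, 1 < F (Y s hs x) ∧ ∀ i, inner ℝ (x i) (Y s hs x) ≤ 1} := by
    rintro x ⟨y, hy, hx⟩
    obtain ⟨z, hz, hFz⟩ := exists_extremePoint_lt (isCompact_setOf_inner_withSmallCross_le m x)
      (convex_setOf_inner_le _) hF hFc hx hy
    obtain ⟨s, hs, hli, hsz⟩ := exists_finset_active_of_mem_extremePoints hz
    rw [finrank_euclideanSpace_fin] at hs
    have hzY : z = Y s hs x := eq_systemSolution
      (hli.comp (idx s hs) (Finset.equivFinOfCardEq hs).symm.injective)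
      fun k => hsz _ (idx s hs k).2
    refine Set.mem_biUnion (x := s) (by simp [hs]) ⟨hs, ?_⟩
    rw [← hzY]
    exact ⟨hFz, (forall_inner_withSmallCross_le.1 hz.1).1⟩
  refine (measure_mono hsub).trans ((measure_biUnion_finset_le _ _).trans ?_)
  calc _ ≤ ∑ s ∈ (Finset.powersetCard n Finset.univ :
      Finset (Finset (Fin N ⊕ (Fin n ⊕ Fin n)))), r ^ (N - n) := by
        refine Finset.sum_le_sum fun s hs => ?_
        have hs' : s.card = n := (Finset.mem_powersetCard.1 hs).2
        have hYm : Measurable (Y s hs') := by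
          refine measurable_systemSolution.comp (measurable_pi_lambda _ fun k => ?_)
          rcases (idx s hs' k : Fin N ⊕ (Fin n ⊕ Fin n)) with i | i
          · exact measurable_pi_apply i
          · exact measurable_const
        -- Cross points are deterministic, so only the random points among the n active ones are
        -- used up; there are at most n of them.
        have hYd : DependsOn (Y s hs') (s.toLeft : Finset (Fin N)) := by
          intro x x' hxx
          dsimp only [Y]
          congr 1; funext k
          obtain ⟨i, hi⟩ := idx s hs' k
          rcases i with i | i
          · exact hxx i (by simpa using hi)
          · rfl
        have := pi_measure_halfspace_le μ s.toLeft hYm hYd (A := {y | 1 < F y})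
          (measurableSet_lt measurable_const hFc.measurable) hr
        refine (measure_mono ?_).trans (this.trans ?_)
        · rintro x ⟨_, hx⟩
          exact hx
        · refine pow_le_pow_right_of_le_one' hr1 ?_
          have := Finset.card_toLeft_le (u := s)
          simp only [Fintype.card_fin]
          omega
    _ = _ := by
        rw [Finset.sum_const, Finset.card_powersetCard, Finset.card_univ, nsmul_eq_mul]
        simp [two_mul]

/-! ### The uniform measure on a centered convex body and its half-spaces -/

theorem setAverage_eq_integral_cond {α E : Type*} [MeasurableSpace α] [NormedAddCommGroup E]
    [NormedSpace ℝ E] (μ : Measure α) (s : Set α) (f : α → E) :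
    ⨍ x in s, f x ∂μ = ∫ x, f x ∂(ProbabilityTheory.cond μ s) := by
  rw [average, Measure.restrict_apply_univ, ProbabilityTheory.cond]

namespace ConvexBody

variable {n : ℕ} (K : ConvexBody (EuclideanSpace ℝ (Fin n)))

/-- The uniform probability measure on a convex body. -/
noncomputable abbrev unif : Measure (EuclideanSpace ℝ (Fin n)) :=
  ProbabilityTheory.cond volume (K : Set _)

theorem measurableSet_coe : MeasurableSet (K : Set (EuclideanSpace ℝ (Fin n))) :=
  K.isCompact.measurableSet

variable {K}

theorem volume_ne_zero (hK : (interior (K : Set (EuclideanSpace ℝ (Fin n)))).Nonempty) :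
    volume (K : Set (EuclideanSpace ℝ (Fin n))) ≠ 0 :=
  (Measure.measure_pos_of_nonempty_interior _ hK).ne'

theorem isProbabilityMeasure_unif
    (hK : (interior (K : Set (EuclideanSpace ℝ (Fin n)))).Nonempty) :
    IsProbabilityMeasure K.unif :=
  cond_isProbabilityMeasure_of_finite (volume_ne_zero hK) K.isCompact.measure_lt_top.ne

theorem integrable_unif (hK : (interior (K : Set (EuclideanSpace ℝ (Fin n)))).Nonempty)
    {E : Type*} [NormedAddCommGroup E] {f : EuclideanSpace ℝ (Fin n) → E} (hf : Continuous f) :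
    Integrable f K.unif := by
  unfold unif ProbabilityTheory.cond
  exact (hf.continuousOn.integrableOn_compact K.isCompact).smul_measure
    (by simpa using volume_ne_zero hK)

theorem integral_inner_unif_eq_zero
    (hK : (interior (K : Set (EuclideanSpace ℝ (Fin n)))).Nonempty)
    (hc : centerOfMass (K : Set (EuclideanSpace ℝ (Fin n))) = 0) (y : EuclideanSpace ℝ (Fin n)) :
    ∫ x, inner ℝ x y ∂K.unif = 0 := by
  simp_rw [real_inner_comm y]
  rw [integral_inner (integrable_unif hK continuous_id'), ← setAverage_eq_integral_cond]
  change inner ℝ y (centerOfMass (K : Set _)) = 0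
  rw [hc, inner_zero_right]

/-- Midpoints of points of K in the half-spaces at heights s and t stay in K and reach height
(s+t)/2, so Prékopa–Leindler for indicators applies. -/
theorem unif_halfspace_mul_le (y : EuclideanSpace ℝ (Fin n)) (s t : ℝ) :
    K.unif.real {x | s ≤ inner ℝ x y} * K.unif.real {x | t ≤ inner ℝ x y}
      ≤ K.unif.real {x | (s + t) / 2 ≤ inner ℝ x y} ^ 2 := by
  have hm : ∀ t : ℝ, MeasurableSet ((K : Set (EuclideanSpace ℝ (Fin n))) ∩ {x | t ≤ inner ℝ x y}) :=
    fun t => K.measurableSet_coe.inter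
      (measurableSet_le measurable_const (by fun_prop))
  have key := (prekopaLeindler_euclideanSpace n).measure_mul_measure_le (hm s) (hm t)
    (hm ((s + t) / 2)) fun x hx x' hx' => by
      refine ⟨K.convex.midpoint_mem hx.1 hx'.1, ?_⟩
      have h1 : s ≤ inner ℝ x y := hx.2
      have h2 : t ≤ inner ℝ x' y := hx'.2
      change (s + t) / 2 ≤ inner ℝ (midpoint ℝ x x') y
      rw [midpoint_eq_smul_add, inner_smul_left, inner_add_left]
      simp only [invOf_eq_inv, conj_trivial]
      linarith
  simp only [unif, measureReal_def, cond_apply K.measurableSet_coe, ENNReal.toReal_mul]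
  have key' := ENNReal.toReal_mono (ENNReal.pow_ne_top
    (measure_ne_top_of_subset Set.inter_subset_left K.isCompact.measure_lt_top.ne)) key
  rw [ENNReal.toReal_mul, ENNReal.toReal_pow] at key'
  rw [mul_mul_mul_comm, mul_pow, sq]
  gcongr

/-- Half-spaces reaching a fixed fraction of the support function of `Z_q⁺(K)` have mass at least
`2^(-q-4)`. -/
theorem two_rpow_le_unif_halfspace
    (hK : (interior (K : Set (EuclideanSpace ℝ (Fin n)))).Nonempty)
    (hc : centerOfMass (K : Set (EuclideanSpace ℝ (Fin n))) = 0) {q t : ℝ} (hq : 1 ≤ q)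
    (ht : 0 ≤ t) (y : EuclideanSpace ℝ (Fin n))
    (h : (8 * t) ^ q ≤ 2 * ∫ x, max (inner ℝ x y) 0 ^ q ∂K.unif) :
    (2 : ℝ) ^ (-q - 4) ≤ K.unif.real {x | t ≤ inner ℝ x y} := by
  have := isProbabilityMeasure_unif hK
  have hf : Continuous fun x : EuclideanSpace ℝ (Fin n) => (inner ℝ x y : ℝ) := by fun_prop
  have hIci : ∀ t, (K.unif.map fun x => inner ℝ x y).real (Set.Ici t)
      = K.unif.real {x | t ≤ inner ℝ x y} := fun t => by
    rw [measureReal_def, Measure.map_apply hf.measurable measurableSet_Ici]; rfl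
  have : IsProbabilityMeasure (K.unif.map fun x => inner ℝ x y) :=
    Measure.isProbabilityMeasure_map hf.aemeasurable
  rw [← hIci]
  refine two_rpow_le_measureReal_Ici (fun s t => ?_) ?_ ?_ hq ht ?_
  · simp only [hIci]
    exact unif_halfspace_mul_le y s t
  · exact (integrable_map_measure measurable_id'.aestronglyMeasurable hf.aemeasurable).2
      (integrable_unif hK hf)
  · rw [integral_map hf.aemeasurable measurable_id'.aestronglyMeasurable]
    exact integral_inner_unif_eq_zero hK hc y
  · rwa [integral_map hf.aemeasurable
      ((measurable_id'.max measurable_const).pow_const q).aestronglyMeasurable]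

theorem continuous_max_inner_rpow {q : ℝ} (hq : 0 ≤ q) (y : EuclideanSpace ℝ (Fin n)) :
    Continuous fun x => max (inner ℝ x y) 0 ^ q :=
  ((by fun_prop : Continuous fun x => (inner ℝ x y : ℝ)).max continuous_const).rpow_const
    fun _ => Or.inr hq

theorem convexOn_integral_max_inner_rpow
    (hK : (interior (K : Set (EuclideanSpace ℝ (Fin n)))).Nonempty) {q : ℝ} (hq : 1 ≤ q) :
    ConvexOn ℝ Set.univ fun y => ∫ x, max (inner ℝ x y) 0 ^ q ∂K.unif := by
  have hint : ∀ y, Integrable (fun x => max (inner ℝ x y) 0 ^ q) K.unif := fun y =>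
    integrable_unif hK (continuous_max_inner_rpow (by linarith) y)
  refine ⟨convex_univ, fun y _ z _ a b ha hb hab => ?_⟩
  simp only [smul_eq_mul]
  rw [← integral_const_mul, ← integral_const_mul,
    ← integral_add ((hint y).const_mul a) ((hint z).const_mul b)]
  refine integral_mono (hint _) (((hint y).const_mul a).add ((hint z).const_mul b)) fun x => ?_
  have h1 : max (inner ℝ x (a • y + b • z)) 0
      ≤ a * max (inner ℝ x y) 0 + b * max (inner ℝ x z) 0 := by
    rw [inner_add_right, inner_smul_right, inner_smul_right]
    refine max_le ?_ (by positivity)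
    gcongr <;> exact le_max_left _ _
  refine (Real.rpow_le_rpow (le_max_right _ _) h1 (by linarith)).trans ?_
  exact (convexOn_rpow hq).2 (Set.mem_Ici.2 (le_max_right _ _))
    (Set.mem_Ici.2 (le_max_right _ _)) ha hb hab

/-- If the integral vanished, ⟨x, y⟩ would be a.e. nonpositive with mean zero, hence a.e. zero,
putting K in a hyperplane up to a null set. -/
theorem integral_max_inner_rpow_pos
    (hK : (interior (K : Set (EuclideanSpace ℝ (Fin n)))).Nonempty)
    (hc : centerOfMass (K : Set (EuclideanSpace ℝ (Fin n))) = 0) {q : ℝ} (hq : 1 ≤ q)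
    {y : EuclideanSpace ℝ (Fin n)} (hy : y ≠ 0) :
    0 < ∫ x, max (inner ℝ x y) 0 ^ q ∂K.unif := by
  have := isProbabilityMeasure_unif hK
  have hint := integrable_unif hK (continuous_max_inner_rpow (by linarith : 0 ≤ q) y)
  refine lt_of_le_of_ne (integral_nonneg fun x => by positivity) fun h0 => ?_
  rw [eq_comm, integral_eq_zero_iff_of_nonneg (fun x => by positivity) hint] at h0
  have hle : ∀ᵐ x ∂K.unif, 0 ≤ -(inner ℝ x y : ℝ) := by
    filter_upwards [h0] with x hx
    have : max (inner ℝ x y : ℝ) 0 ^ q = 0 := hx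
    rw [Real.rpow_eq_zero (le_max_right _ _) (by linarith)] at this
    have := le_max_left (inner ℝ x y : ℝ) 0
    linarith
  have hzero : ∀ᵐ x ∂K.unif, -(inner ℝ x y : ℝ) = 0 := by
    refine (integral_eq_zero_iff_of_nonneg_ae hle (integrable_unif hK (by fun_prop))).1 ?_
    rw [integral_neg, integral_inner_unif_eq_zero hK hc, neg_zero]
  let W : Submodule ℝ (EuclideanSpace ℝ (Fin n)) := (ℝ ∙ y)ᗮ
  have hnull : volume (W : Set (EuclideanSpace ℝ (Fin n))) = 0 := by
    refine Measure.addHaar_submodule _ _ fun h => hy ?_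
    have hmem : y ∈ W := h ▸ Submodule.mem_top
    exact inner_self_eq_zero.1 (Submodule.mem_orthogonal_singleton_iff_inner_right.1 hmem)
  have hnull' : K.unif (W : Set (EuclideanSpace ℝ (Fin n))) = 0 :=
    cond_absolutelyContinuous hnull
  have hfalse : ∀ᵐ x ∂K.unif, False := by
    filter_upwards [hzero, measure_eq_zero_iff_ae_notMem.1 hnull'] with x hx hx'
    exact hx' (Submodule.mem_orthogonal_singleton_iff_inner_left.2 (by linarith))
  exact hfalse.exists.elim fun _ h => h

theorem oneSidedSupportFun_eq (q : ℝ) (y : EuclideanSpace ℝ (Fin n)) :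
    oneSidedSupportFun (K : Set _) q y = (2 * ∫ x, max (inner ℝ x y) 0 ^ q ∂K.unif) ^ (1 / q) := by
  rw [oneSidedSupportFun, setAverage_eq_integral_cond]

theorem integral_max_inner_smul_rpow {q c : ℝ} (hc : 0 ≤ c) (y : EuclideanSpace ℝ (Fin n)) :
    ∫ x, max (inner ℝ x (c • y)) 0 ^ q ∂K.unif
      = c ^ q * ∫ x, max (inner ℝ x y) 0 ^ q ∂K.unif := by
  rw [← integral_const_mul]
  congr 1; funext x
  rw [inner_smul_right, ← Real.mul_rpow hc (le_max_right _ _), mul_max_of_nonneg _ _ hc, mul_zero]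

/-- If the convex hull of finitely many points does not contain `(1/8) Z_q⁺(K)`, then some
half-space which reaches beyond `(1/8) Z_q⁺(K)` contains none of the points in its interior. -/
theorem exists_empty_halfspace
    (hK : (interior (K : Set (EuclideanSpace ℝ (Fin n)))).Nonempty)
    (hc : centerOfMass (K : Set (EuclideanSpace ℝ (Fin n))) = 0) {q : ℝ} (hq : 1 ≤ q) {N : ℕ}
    (hN : 0 < N) (x : Fin N → EuclideanSpace ℝ (Fin n))
    (hx : ¬ (1 / 8 : ℝ) • oneSidedCentroidBody (K : Set (EuclideanSpace ℝ (Fin n))) q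
      ⊆ convexHull ℝ (Set.range x)) :
    ∃ y, 1 < 2 * (8 ^ q)⁻¹ * (∫ x, max (inner ℝ x y) 0 ^ q ∂K.unif) ∧
      ∀ i, inner ℝ (x i) y ≤ 1 := by
  have hq0 : 0 < q := by linarith
  obtain ⟨_, ⟨z, hz, rfl⟩, hzx⟩ := Set.not_subset.1 hx
  obtain ⟨f, u, hfu, hfz⟩ := geometric_hahn_banach_closed_point (convex_convexHull ℝ _)
    ((Set.finite_range x).isClosed_convexHull ℝ) hzx
  obtain ⟨y, rfl⟩ := (InnerProductSpace.toDual ℝ (EuclideanSpace ℝ (Fin n))).surjective f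
  simp only [InnerProductSpace.toDual_apply_apply] at hfu hfz
  rw [real_inner_comm, real_inner_smul_left] at hfz
  have hxi : ∀ i, inner ℝ (x i) y < u := fun i => by
    rw [real_inner_comm]
    exact hfu _ (subset_convexHull ℝ _ ⟨i, rfl⟩)
  have hzy := hz y
  rw [oneSidedSupportFun_eq] at hzy
  set J := ∫ x, max (inner ℝ x y) 0 ^ q ∂K.unif with hJ
  have hJ0 : 0 ≤ J := integral_nonneg fun x => by positivity
  set H := (2 * J) ^ (1 / q) with hH
  have hH0 : 0 ≤ H := by positivity
  have hHq : H ^ q = 2 * J := by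
    rw [hH, ← Real.rpow_mul (by positivity), one_div_mul_cancel hq0.ne', Real.rpow_one]
  have huH : u < H / 8 := by linarith
  have hy0 : y ≠ 0 := by
    rintro rfl
    have h1 := hxi ⟨0, hN⟩
    simp only [inner_zero_right, mul_zero] at h1 hfz
    linarith
  have hJpos : 0 < J := integral_max_inner_rpow_pos hK hc hq hy0
  have hHpos : 0 < H := by positivity
  -- The separating level u may be nonpositive, so y is rescaled by a positive level v strictly
  -- between max u 0 and H/8.
  obtain ⟨v, huv, hvH⟩ := exists_between (max_lt huH (by positivity : 0 < H / 8))
  have hv : 0 < v := (le_max_right _ _).trans_lt huv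
  refine ⟨v⁻¹ • y, ?_, fun i => ?_⟩
  · rw [integral_max_inner_smul_rpow (by positivity), ← hJ,
      show 2 * (8 ^ q)⁻¹ * (v⁻¹ ^ q * J) = (8 ^ q)⁻¹ * v⁻¹ ^ q * (2 * J) by ring, ← hHq,
      ← Real.inv_rpow (by norm_num), ← Real.mul_rpow (by norm_num) (by positivity),
      ← Real.mul_rpow (by positivity) hH0]
    refine Real.one_lt_rpow ?_ hq0
    rw [show (8 : ℝ)⁻¹ * v⁻¹ * H = H / 8 / v by ring]
    exact (one_lt_div hv).2 hvH
  · rw [inner_smul_right, inv_mul_le_iff₀ hv, mul_one]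
    exact ((hxi i).trans_le ((le_max_left _ _).trans huv.le)).le

end ConvexBody

/-! ### Choice of α and the numerical estimate -/

/-- The power r^(1-β/2) dominates everything else: for large r the constants, log r and r^(1-β) each
cost at most an eighth of it. -/
theorem exists_threshold {β : ℝ} (hβ : 0 < β) (hβ1 : β < 1) :
    ∃ α > (1 : ℝ), ∀ r ≥ α, 2 ≤ r ∧ 1 ≤ β * Real.log r / 8 ∧
      1 + Real.log 3 + Real.log r + r ^ (1 - β) < r ^ (1 - β / 2) / 2 := by
  have h1 : 0 < 1 - β / 2 := by linarith
  have e1 := (isLittleO_log_rpow_atTop h1).def (by norm_num : (0 : ℝ) < 1 / 8)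
  have e2 := (tendsto_rpow_neg_atTop (half_pos hβ)).eventually
    (gt_mem_nhds (by norm_num : (0 : ℝ) < 1 / 8))
  have e3 := (tendsto_rpow_atTop h1).eventually_ge_atTop (8 * (1 + Real.log 3))
  have e4 := Real.tendsto_log_atTop.eventually_ge_atTop (8 / β)
  have e5 := Filter.eventually_ge_atTop (2 : ℝ)
  obtain ⟨α, hα⟩ := Filter.eventually_atTop.1 (e1.and (e2.and (e3.and (e4.and e5))))
  refine ⟨max α 2, lt_max_of_lt_right (by norm_num), fun r hr => ?_⟩
  obtain ⟨e1, e2, e3, e4, e5⟩ := hα r ((le_max_left _ _).trans hr)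
  have hr0 : 0 < r := by linarith
  have hpos : 0 < r ^ (1 - β / 2) := by positivity
  refine ⟨e5, ?_, ?_⟩
  · rw [div_le_iff₀ hβ] at e4
    linarith
  · rw [Real.norm_of_nonneg (Real.log_nonneg (by linarith)), Real.norm_of_nonneg hpos.le] at e1
    have h2 : r ^ (1 - β) = r ^ (1 - β / 2) * r ^ (-(β / 2)) := by
      rw [← Real.rpow_add hr0]; congr 1; ring
    rw [h2]
    nlinarith

theorem choose_le_exp_mul_pow {n M : ℕ} (hn : 1 ≤ n) :
    (M.choose n : ℝ) ≤ (Real.exp 1 * (M / n)) ^ n := by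
  have hn0 : (0 : ℝ) < n := by exact_mod_cast hn
  have h1 : (n : ℝ) ^ n / n.factorial ≤ Real.exp n := Real.pow_div_factorial_le_exp n hn0.le n
  calc (M.choose n : ℝ) ≤ (M : ℝ) ^ n / n.factorial := Nat.choose_le_pow_div n M
    _ = ((M : ℝ) / n) ^ n * ((n : ℝ) ^ n / n.factorial) := by
        rw [div_pow]; field_simp
    _ ≤ ((M : ℝ) / n) ^ n * Real.exp n := by gcongr
    _ = (Real.exp 1 * (M / n)) ^ n := by
        rw [mul_pow, ← Real.exp_nat_mul, mul_one, mul_comm]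

theorem choose_mul_one_sub_pow_lt {β : ℝ} {n N : ℕ} (hn : 1 ≤ n)
    (h2 : 2 ≤ (N / n : ℝ)) (hq : 1 ≤ β * Real.log (N / n) / 8)
    (h : 1 + Real.log 3 + Real.log (N / n) + (N / n : ℝ) ^ (1 - β)
      < (N / n : ℝ) ^ (1 - β / 2) / 2) :
    ((N + 2 * n).choose n : ℝ) * (1 - 2 ^ (-(β * Real.log (N / n) / 8) - 4)) ^ (N - n)
      < Real.exp (-((N : ℝ) ^ (1 - β) * (n : ℝ) ^ β)) := by
  have hn0 : (0 : ℝ) < n := by exact_mod_cast hn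
  set r : ℝ := N / n with hr
  have hr0 : 0 < r := by linarith
  have hN : (N : ℝ) = r * n := by rw [hr]; field_simp
  set q := β * Real.log r / 8 with hqdef
  set p : ℝ := 2 ^ (-q - 4) with hp
  have hp1 : p ≤ 1 := Real.rpow_le_one_of_one_le_of_nonpos (by norm_num) (by linarith)
  -- This fixes the 1/8 in q: r^(-β/2) = e^(-4q), and (q+4) log 2 ≤ 5q log 2 < 4q because q ≥ 1.
  have hpr : r ^ (-(β / 2)) ≤ p := by
    rw [hp, Real.rpow_def_of_pos hr0, Real.rpow_def_of_pos (by norm_num : (0 : ℝ) < 2)]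
    refine Real.exp_le_exp.2 ?_
    have hl2 := Real.log_two_lt_d9
    have hl0 : 0 < Real.log 2 := Real.log_pos (by norm_num)
    have : Real.log r * -(β / 2) = -4 * q := by rw [hqdef]; ring
    rw [this]
    nlinarith
  have hNn : n ≤ N := by
    have : (n : ℝ) ≤ N := by rw [hN]; nlinarith
    exact_mod_cast this
  -- Here (N+2n)/n = r + 2 ≤ 3r, whence the term log 3.
  have hchoose : ((N + 2 * n).choose n : ℝ)
      ≤ Real.exp (n * (1 + Real.log 3 + Real.log r)) := by
    refine (choose_le_exp_mul_pow hn).trans ?_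
    rw [Real.exp_nat_mul, Real.exp_add, Real.exp_add, Real.exp_log (by norm_num), Real.exp_log hr0,
      mul_assoc]
    gcongr
    push_cast
    rw [hN, div_le_iff₀ hn0]
    nlinarith
  have hpow : (1 - p) ^ (N - n) ≤ Real.exp (-(n * (r ^ (1 - β / 2) / 2))) := by
    calc (1 - p) ^ (N - n) ≤ Real.exp (-p) ^ (N - n) :=
          pow_le_pow_left₀ (by linarith) (Real.one_sub_le_exp_neg p) _
      _ = Real.exp (-(p * (N - n))) := by
          rw [← Real.exp_nat_mul, Nat.cast_sub hNn]; congr 1; ring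
      _ ≤ _ := by
          refine Real.exp_le_exp.2 (neg_le_neg ?_)
          have h3 : r ^ (1 - β / 2) = r ^ (-(β / 2)) * r := by
            rw [← Real.rpow_add_one hr0.ne']; congr 1; ring
          calc (n : ℝ) * (r ^ (1 - β / 2) / 2) = r ^ (-(β / 2)) * (n * (r / 2)) := by
                rw [h3]; ring
            _ ≤ p * (N - n) := by
                gcongr
                rw [hN]; nlinarith
  have hexp : (N : ℝ) ^ (1 - β) * (n : ℝ) ^ β = n * r ^ (1 - β) := by
    rw [hN, Real.mul_rpow hr0.le hn0.le, mul_assoc, ← Real.rpow_add hn0]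
    simp [mul_comm]
  rw [hexp]
  calc _ ≤ Real.exp (n * (1 + Real.log 3 + Real.log r))
        * Real.exp (-(n * (r ^ (1 - β / 2) / 2))) := by
        have : 0 ≤ 1 - p := by linarith
        gcongr
    _ = Real.exp (n * (1 + Real.log 3 + Real.log r - r ^ (1 - β / 2) / 2)) := by
        rw [← Real.exp_add]; congr 1; ring
    _ < _ := by
        refine Real.exp_lt_exp.2 ?_
        rw [← mul_neg]
        gcongr
        linarith

/-! ### Assembly -/

theorem theorem3p3 :
    ∃ c₁ > (0 : ℝ), ∃ c₂ > (0 : ℝ), ∀ β : ℝ, 0 < β → β < 1 →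
      ∃ α > (1 : ℝ), ∀ n : ℕ, 1 ≤ n →
        ∀ K : ConvexBody (EuclideanSpace ℝ (Fin n)),
          (interior (K : Set (EuclideanSpace ℝ (Fin n)))).Nonempty →
          centerOfMass (K : Set (EuclideanSpace ℝ (Fin n))) = 0 →
          ∀ N : ℕ, α * n ≤ N →
            ∃ q : ℝ, 1 ≤ q ∧ c₁ * β * Real.log (N / n) ≤ q ∧
              ∀ (Ω : Type*) [MeasurableSpace Ω] (P : Measure Ω) [IsProbabilityMeasure P]
                (X : Fin N → Ω → EuclideanSpace ℝ (Fin n)),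
                (∀ i, Measurable (X i)) →
                iIndepFun X P →
                (∀ i, pdf.IsUniform (X i) (K : Set (EuclideanSpace ℝ (Fin n))) P volume) →
                1 - Real.exp (-((N : ℝ) ^ (1 - β) * (n : ℝ) ^ β)) <
                  P.real {ω | c₂ • oneSidedCentroidBody (K : Set (EuclideanSpace ℝ (Fin n))) q ⊆
                    convexHull ℝ (Set.range fun i => X i ω)} := by
  refine ⟨1 / 8, by norm_num, 1 / 8, by norm_num, fun β hβ hβ1 => ?_⟩
  obtain ⟨α, hα1, hα⟩ := exists_threshold hβ hβ1
  refine ⟨α, hα1, fun n hn K hK hc N hN => ?_⟩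
  have hn0 : (0 : ℝ) < n := by exact_mod_cast hn
  obtain ⟨h2, hq, hlt⟩ := hα (N / n) ((le_div_iff₀ hn0).2 hN)
  have hN0 : 0 < N := by
    have : (0 : ℝ) < N := lt_of_lt_of_le (by positivity) hN
    exact_mod_cast this
  have hfinal := choose_mul_one_sub_pow_lt hn h2 hq hlt
  set q := β * Real.log (N / n) / 8 with hqdef
  refine ⟨q, hq, by rw [hqdef]; linarith, ?_⟩
  intro Ω _ P _ X hX hind hunif
  have hprob := ConvexBody.isProbabilityMeasure_unif hK
  set p : ℝ := 2 ^ (-q - 4) with hp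
  have hp0 : 0 < p := by positivity
  have hp1 : p ≤ 1 := Real.rpow_le_one_of_one_le_of_nonpos (by norm_num) (by linarith)
  -- F is (h/8)^q; without the q-th root its convexity is immediate, and continuity follows from
  -- convexity in finite dimension.
  set F : EuclideanSpace ℝ (Fin n) → ℝ := fun y =>
    2 * (8 ^ q)⁻¹ * ∫ x, max (inner ℝ x y) 0 ^ q ∂K.unif with hFdef
  have hF : ConvexOn ℝ Set.univ F :=
    (ConvexBody.convexOn_integral_max_inner_rpow hK hq).smul (by positivity)
  have hFc : Continuous F := by
    rw [← continuousOn_univ]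
    exact hF.continuousOn isOpen_univ
  have hr : ∀ y, 1 < F y → K.unif {x | inner ℝ x y ≤ 1} ≤ ENNReal.ofReal (1 - p) := by
    intro y hy
    -- A level strictly above 1 makes {t ≤ ⟨x, y⟩} disjoint from {⟨x, y⟩ ≤ 1}.
    obtain ⟨t, ht1, htF⟩ : ∃ t > (1 : ℝ), t ^ q ≤ F y := by
      refine ⟨F y ^ (1 / q), Real.one_lt_rpow hy (by positivity), le_of_eq ?_⟩
      rw [← Real.rpow_mul (by linarith), one_div_mul_cancel (by linarith), Real.rpow_one]
    have hmass := ConvexBody.two_rpow_le_unif_halfspace hK hc hq (by linarith : 0 ≤ t) y (by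
      rw [Real.mul_rpow (by norm_num) (by linarith)]
      have h8 : (0 : ℝ) < 8 ^ q := by positivity
      calc (8 : ℝ) ^ q * t ^ q ≤ 8 ^ q * F y := by gcongr
        _ = _ := by rw [hFdef]; field_simp)
    have hms : MeasurableSet {x : EuclideanSpace ℝ (Fin n) | t ≤ inner ℝ x y} :=
      measurableSet_le measurable_const (by fun_prop)
    rw [← ofReal_measureReal]
    refine ENNReal.ofReal_le_ofReal ?_
    have hcompl := probReal_add_probReal_compl (μ := K.unif) hms
    have hle : K.unif.real {x | inner ℝ x y ≤ 1}
        ≤ K.unif.real {x : EuclideanSpace ℝ (Fin n) | t ≤ inner ℝ x y}ᶜ :=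
      measureReal_mono fun x (hx : inner ℝ x y ≤ 1) => not_le.2 (hx.trans_lt ht1)
    linarith
  have hbound := pi_measure_exists_halfspace_le K.unif hF hFc
    (ENNReal.ofReal_le_one.2 (by linarith)) hr N
  have hmap : P.map (fun ω i => X i ω) = Measure.pi fun _ : Fin N => K.unif := by
    rw [(iIndepFun_iff_map_fun_eq_pi_map fun i => (hX i).aemeasurable).1 hind]
    congr 1; funext i
    exact hunif i
  set good := {ω | (1 / 8 : ℝ) • oneSidedCentroidBody (K : Set (EuclideanSpace ℝ (Fin n))) q ⊆
    convexHull ℝ (Set.range fun i => X i ω)} with hgood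
  have hbad : P goodᶜ ≤ (N + 2 * n).choose n * ENNReal.ofReal (1 - p) ^ (N - n) := by
    refine le_trans (measure_mono fun ω hω => ?_)
      ((Measure.le_map_apply (measurable_pi_lambda _ hX).aemeasurable _).trans
        (hmap ▸ hbound))
    exact ConvexBody.exists_empty_halfspace hK hc hq hN0 (fun i => X i ω) hω
  have hbad' : P.real goodᶜ ≤ ((N + 2 * n).choose n : ℝ) * (1 - p) ^ (N - n) := by
    refine ENNReal.toReal_le_of_le_ofReal (by
      have : 0 ≤ 1 - p := by linarith
      positivity) (hbad.trans_eq ?_)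
    rw [ENNReal.ofReal_mul (by positivity), ENNReal.ofReal_pow (by linarith),
      ENNReal.ofReal_natCast]
  -- Subadditivity suffices, so the measurability of `good` is never needed.
  have hone : 1 ≤ P.real good + P.real goodᶜ := by
    have := measureReal_union_le (μ := P) good goodᶜ
    rwa [Set.union_compl_self, probReal_univ] at this
  linarith
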